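/- Let $\mathbb{N}_2$ be the set of unordered pairs $e=\{i,j\}$ of distinct natural numbers, and let $\mu$ be a probability measure on $\mathbb{N}_2$. Write $\mu_e=\mu(\{e\})$, $\mu_{ij}=\mu(\{\{i,j\}\})$ for $i\neq j$ (and $\mu_{ii}=0$), $M_i=\sum_j\mu_{ij}$, and $M_e=M_i+M_j-\mu_{ij}$ for $e=\{i,j\}$. Assume that * the support of $\mu$, that is, the graph whose edges are all $e\in\mathbb{N}_2$ with $\mu_e>0$ and whose vertices are the endpoints of these edges, is connected, and * $\displaystyle\sum_{e\in\mathbb{N}_2}\frac{\mu_e}{M_e}<\infty$, where a term with $\mu_e=0$ is read as $0$. Discrete time: let $e_1,e_2,\dots$ be independent random edges, each with law $\mu$, let $G_0$ be the empty graph, and let $G_{n+1}=G_n\cup e_{n+1}$, i.e. $G_{n+1}$ is obtained from $G_n$ by adding the edge $e_{n+1}$ and its two endpoints (parallel edges are identified). Continuous time: let $(N_e(t))_{t\ge 0}$, $e\in\mathbb{N}_2$, be independent Poisson processes, $N_e$ having intensity $\mu_e$, and let $G_t$ be the graph whose edges are all $e$ with $N_e(t)>0$ and whose vertices are the endpoints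 of these edges. Then $$\lim_{n\to\infty}P(G_n\text{ is connected})=1\qquad\text{and}\qquad\lim_{t\to\infty}P(G_t\text{ is connected})=1 .$$ -/

import Mathlib

open MeasureTheory ProbabilityTheory Filter Topology
open scoped NNReal ENNReal

namespace EdgeExch

/-- The set `ℕ₂` of unordered pairs of distinct natural numbers (the possible edges),
with the discrete σ-algebra. -/
def Edge : Type := {e : Sym2 ℕ // ¬ e.IsDiag}

instance : Countable Edge := inferInstanceAs (Countable {e : Sym2 ℕ // ¬ e.IsDiag})

instance : MeasurableSpace Edge := ⊤

instance : DiscreteMeasurableSpace Edge := ⟨fun _ => trivial⟩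

/-- The endpoints of an edge, as an unordered pair. -/
def Edge.ends (e : Edge) : Sym2 ℕ := e.1

/-- The graph spanned by a set `S` of edges: its edges are those of `S`, its vertices are the
endpoints of the edges of `S` (so there are no isolated vertices). -/
def edgeGraph (S : Set Edge) : (⊤ : SimpleGraph ℕ).Subgraph where
  verts := {v | ∃ e ∈ S, v ∈ e.ends}
  Adj v w := ∃ e ∈ S, e.ends = s(v, w)
  adj_sub := by
    rintro v w ⟨e, -, he⟩ rfl
    exact e.2 (by change e.ends.IsDiag; rw [he]; exact Sym2.mk_isDiag_iff.2 rfl)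
  edge_vert := by
    rintro v w ⟨e, heS, he⟩
    exact ⟨e, heS, by rw [he]; exact Sym2.mem_mk_left v w⟩
  symm := ⟨by
    rintro v w ⟨e, heS, he⟩
    exact ⟨e, heS, by rw [he, Sym2.eq_swap]⟩⟩

section Measure

variable (μ : Measure Edge)

/-- The support of `μ`, as a graph: the edges of positive mass and their endpoints. -/
def supportGraph : (⊤ : SimpleGraph ℕ).Subgraph := edgeGraph {e | 0 < μ {e}}

/-- `μ_{ij} = μ({{i,j}})`; this is `0` for `i = j`, as `ℕ₂` has no loops. -/
noncomputable def pairMass (i j : ℕ) : ℝ := μ.real {e | e.ends = s(i, j)}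

lemma pairMass_comm (i j : ℕ) : pairMass μ i j = pairMass μ j i := by
  simp only [pairMass, Sym2.eq_swap]

/-- `M_i = ∑_j μ_{ij}`. -/
noncomputable def vertexMass (i : ℕ) : ℝ := ∑' j, pairMass μ i j

/-- `M_e = M_i + M_j - μ_{ij}` for `e = {i,j}`. -/
noncomputable def edgeMass (e : Edge) : ℝ :=
  Sym2.lift ⟨fun i j => vertexMass μ i + vertexMass μ j - pairMass μ i j, fun i j => by
    change _ - _ = _ - _
    rw [pairMass_comm μ i j, add_comm (vertexMass μ i)]⟩ e.ends

end Measure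

/-- The graph `G_n` (parallel edges identified) built from a sequence of edges:
`G_0` is the empty graph and `G_{n+1} = G_n ∪ e_{n+1}`. The sequence `x` is indexed from `0`,
so `x n` is the `(n+1)`-st edge. -/
def discreteGraph (x : ℕ → Edge) : ℕ → (⊤ : SimpleGraph ℕ).Subgraph
  | 0 => ⊥
  | n + 1 => discreteGraph x n ⊔ edgeGraph {x n}

/-- The graph `G_t` (parallel edges identified) in which the edge `e` has multiplicity `k e`:
its edges are those of positive multiplicity. -/
def countGraph (k : Edge → ℕ) : (⊤ : SimpleGraph ℕ).Subgraph := edgeGraph {e | 0 < k e}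

/-- `N` is a Poisson process with intensity `r ≥ 0` on the probability space `(Ω, P)`: a counting
process started at `0`, with independent increments, `N t - N s` being Poisson distributed
with parameter `r (t - s)` for `s ≤ t`. -/
structure IsPoissonProcess {Ω : Type*} [MeasurableSpace Ω] (N : ℝ≥0 → Ω → ℕ) (r : ℝ≥0)
    (P : Measure Ω) : Prop where
  measurable : ∀ t, Measurable (N t)
  start : ∀ᵐ ω ∂P, N 0 ω = 0
  monotone : ∀ᵐ ω ∂P, Monotone fun t => N t ω
  rightContinuous : ∀ᵐ ω ∂P, ∀ t, ContinuousWithinAt (fun s => N s ω) (Set.Ici t) t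
  indepIncrements : HasIndepIncrements N P
  law_increment : ∀ s t, s ≤ t →
    HasLaw (fun ω => N t ω - N s ω) (poissonMeasure (r * (t - s))) P

end EdgeExch

namespace EdgeExch

/-! Observe the growing graph at integer times and call an edge born if it appears between times `k`
and `k + 1` while nothing touching it is present at time `k`. Every component contains a born edge,
namely one from the first observation at which any of its edges is present
(`exists_born_reachable`).

The edges touching `e` have total mass `M_e` (`edgeMass_eq`). So `e` is born in step `k` with
probability `(1 - M_e)^k μ_e` in discrete time, and at most `exp(-k M_e) μ_e` in continuous time.
Summing over `k`, `e` is born with probability at most `2 μ_e / M_e`, and by Borel–Cantelli almost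
surely only finitely many edges are born.

Born edges lie in the connected support, all of whose edges eventually appear. Finitely many finite
paths therefore join all births to one fixed vertex from some time on (`eventually_connected`). Thus
the graph is almost surely eventually connected, which gives the limit of the probabilities. -/

/-- Paths are taken in the ambient vertex type, so that reachability in graphs with different vertex
sets can be compared. -/
theorem subgraph_connected_iff {V : Type*} {G : SimpleGraph V} (H : G.Subgraph) :
    H.Connected ↔
      H.verts.Nonempty ∧ ∀ u ∈ H.verts, ∀ v ∈ H.verts, Relation.ReflTransGen H.Adj u v := by
  rw [SimpleGraph.Subgraph.connected_iff, SimpleGraph.Subgraph.preconnected_iff, and_comm]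
  refine and_congr_right fun _ => ⟨fun h u hu v hv => ?_, fun h ⟨u, hu⟩ ⟨v, hv⟩ => ?_⟩
  · have := (SimpleGraph.reachable_iff_reflTransGen _ _).1 (h ⟨u, hu⟩ ⟨v, hv⟩)
    exact this.lift (p := H.Adj) Subtype.val fun a b hab => hab
  · rw [SimpleGraph.reachable_iff_reflTransGen]
    have key : ∀ w, Relation.ReflTransGen H.Adj u w → ∀ hw : w ∈ H.verts,
        Relation.ReflTransGen H.coe.Adj ⟨u, hu⟩ ⟨w, hw⟩ := by
      intro w huw
      induction huw with
      | refl => exact fun _ => .refl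
      | tail _ hbc ih => exact fun hw => (ih hbc.fst_mem).tail hbc
    exact key v (h u hu v hv) hv

theorem reflTransGen_edgeGraph_mono {S T : Set Edge} (h : S ⊆ T) {u v : ℕ}
    (huv : Relation.ReflTransGen (edgeGraph S).Adj u v) :
    Relation.ReflTransGen (edgeGraph T).Adj u v :=
  Relation.ReflTransGen.mono (fun _ _ ⟨e, heS, he⟩ => ⟨e, h heS, he⟩) _ _ huv

theorem reflTransGen_edgeGraph_symm {S : Set Edge} {u v : ℕ}
    (huv : Relation.ReflTransGen (edgeGraph S).Adj u v) :
    Relation.ReflTransGen (edgeGraph S).Adj v u :=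
  haveI : Std.Symm (edgeGraph S).Adj := (edgeGraph S).symm
  Relation.ReflTransGen.stdSymm.symm _ _ huv

theorem reflTransGen_of_mem_ends {S : Set Edge} {e : Edge} (he : e ∈ S) {u v : ℕ}
    (hu : u ∈ e.ends) (hv : v ∈ e.ends) : Relation.ReflTransGen (edgeGraph S).Adj u v := by
  by_cases h : u = v
  · subst h; exact .refl
  · exact .single ⟨e, he, (Sym2.mem_and_mem_iff h).1 ⟨hu, hv⟩⟩

theorem Edge.exists_mem_ends (e : Edge) : ∃ v, v ∈ e.ends := ⟨_, Sym2.out_fst_mem _⟩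

/-- Two edges touch if they share an endpoint; every edge touches itself. -/
def Edge.Touches (e f : Edge) : Prop := ∃ v, v ∈ e.ends ∧ v ∈ f.ends

theorem Edge.touches_self (e : Edge) : e.Touches e :=
  let ⟨v, hv⟩ := e.exists_mem_ends
  ⟨v, hv, hv⟩

/-- The edge `e` is born in the growing family `A` of edge sets if it appears between times `k` and
`k + 1` for some `k`, while at time `k` no edge touching `e` is present. -/
def Born (A : ℕ → Set Edge) (e : Edge) : Prop :=
  ∃ k, e ∈ A (k + 1) ∧ ∀ f, e.Touches f → f ∉ A k

/-! ### Births and connectedness of a deterministic growing graph -/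

section Deterministic

variable {T : Type*} [LinearOrder T]

/-- Every component of a growing graph contains an edge that was born. -/
theorem exists_born_reachable {S : T → Set Edge} (hS : Monotone S) {c : ℕ → T}
    (hc : ∀ t, ∃ k, t ≤ c k) (h0 : S (c 0) = ∅) {t : T} {v : ℕ}
    (hv : v ∈ (edgeGraph (S t)).verts) :
    ∃ e ∈ S t, Born (fun k => S (c k)) e ∧
      ∀ w ∈ e.ends, Relation.ReflTransGen (edgeGraph (S t)).Adj v w := by
  classical
  let Q : ℕ → Prop := fun k => ∃ e ∈ S t, e ∈ S (c k) ∧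
    ∀ w ∈ e.ends, Relation.ReflTransGen (edgeGraph (S t)).Adj v w
  have hQ : ∃ k, Q k := by
    obtain ⟨e, he, hve⟩ := hv
    obtain ⟨k, hk⟩ := hc t
    exact ⟨k, e, he, hS hk he, fun w hw => reflTransGen_of_mem_ends he hve hw⟩
  obtain ⟨e, het, hek, hew⟩ := Nat.find_spec hQ
  have hmin := fun m => Nat.find_min hQ (m := m)
  generalize Nat.find hQ = k at hek hmin
  cases k with
  | zero => simp [h0] at hek
  | succ k =>
    refine ⟨e, het, ⟨k, hek, ?_⟩, hew⟩
    rintro f ⟨w, hwe, hwf⟩ hfk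
    -- Otherwise `e` itself would already be present at the earlier index `k`. This replaces
    -- monotonicity of `c`.
    have hkt : c k ≤ t := by
      by_contra! hlt
      exact hmin k (Nat.lt_succ_self k) ⟨e, het, hS hlt.le het, hew⟩
    exact hmin k (Nat.lt_succ_self k) ⟨f, hS hkt hfk, hfk, fun x hx =>
      (hew w hwe).trans (reflTransGen_of_mem_ends (hS hkt hfk) hwf hx)⟩

theorem eventually_reflTransGen {A : Set Edge} {S : T → Set Edge} (hS : Monotone S)
    (hA : ∀ e ∈ A, ∃ t, e ∈ S t) {u v : ℕ}
    (huv : Relation.ReflTransGen (edgeGraph A).Adj u v) :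
    ∀ᶠ t in atTop, Relation.ReflTransGen (edgeGraph (S t)).Adj u v := by
  induction huv with
  | refl => exact .of_forall fun _ => .refl
  | tail _ hbc ih =>
    obtain ⟨e, heA, he⟩ := hbc
    obtain ⟨s, hs⟩ := hA e heA
    filter_upwards [ih, eventually_ge_atTop s] with t ht hst
    exact ht.tail ⟨e, hS hst hs, he⟩

/-- A growing graph with finitely many births, which fills up a connected graph, is eventually
connected. -/
theorem eventually_connected {A : Set Edge} (hAconn : (edgeGraph A).Connected)
    {S : T → Set Edge} (hS : Monotone S) {c : ℕ → T} (hc : ∀ t, ∃ k, t ≤ c k)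
    (h0 : S (c 0) = ∅) (hsub : ∀ t, S t ⊆ A) (hA : ∀ e ∈ A, ∃ t, e ∈ S t)
    (hfin : {e | Born (fun k => S (c k)) e}.Finite) :
    ∀ᶠ t in atTop, (edgeGraph (S t)).Connected := by
  rw [subgraph_connected_iff] at hAconn
  obtain ⟨⟨v₀, e₀, he₀, hv₀⟩, hreach⟩ := hAconn
  obtain ⟨t₀, ht₀⟩ := hA e₀ he₀
  -- One endpoint of each born edge suffices, since components are reached through births.
  have hpairs : ∀ e ∈ {e | Born (fun k => S (c k)) e},
      ∀ᶠ t in atTop, Relation.ReflTransGen (edgeGraph (S t)).Adj v₀ e.ends.out.1 := by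
    rintro e ⟨k, hek, -⟩
    exact eventually_reflTransGen hS hA
      (hreach _ ⟨e₀, he₀, hv₀⟩ _ ⟨e, hsub _ hek, Sym2.out_fst_mem _⟩)
  filter_upwards [(eventually_all_finite hfin).2 hpairs, eventually_ge_atTop t₀] with t ht htt
  rw [subgraph_connected_iff]
  refine ⟨⟨v₀, e₀, hS htt ht₀, hv₀⟩, ?_⟩
  have hroot : ∀ v ∈ (edgeGraph (S t)).verts,
      Relation.ReflTransGen (edgeGraph (S t)).Adj v₀ v := by
    intro v hv
    obtain ⟨e, -, heb, hw⟩ := exists_born_reachable hS hc h0 hv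
    exact (ht e heb).trans (reflTransGen_edgeGraph_symm (hw _ (Sym2.out_fst_mem _)))
  exact fun u hu v hv => (reflTransGen_edgeGraph_symm (hroot u hu)).trans (hroot v hv)

end Deterministic

theorem edgeGraph_union (S T : Set Edge) : edgeGraph (S ∪ T) = edgeGraph S ⊔ edgeGraph T := by
  ext v w
  · simp [edgeGraph, or_and_right, exists_or]
  · simp [edgeGraph, or_and_right, exists_or]

theorem discreteGraph_eq_edgeGraph (x : ℕ → Edge) (n : ℕ) :
    discreteGraph x n = edgeGraph {e | ∃ k < n, x k = e} := by
  induction n with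
  | zero =>
    ext v w
    · simp [edgeGraph, discreteGraph]
    · simp [edgeGraph, discreteGraph]
  | succ n ih =>
    rw [discreteGraph, ih, ← edgeGraph_union]
    congr 1
    ext e
    simp only [Set.mem_union, Set.mem_ofPred_eq, Set.mem_singleton_iff, Nat.lt_succ_iff_lt_or_eq,
      or_and_right, exists_or, exists_eq_left, @eq_comm _ e]

/-! ### `M_e` as the mass of the edges touching `e` -/

section EdgeMass

variable (μ : Measure Edge) [IsFiniteMeasure μ]

theorem vertexMass_eq (i : ℕ) : vertexMass μ i = μ.real {f | i ∈ f.ends} := by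
  have hU : {f : Edge | i ∈ f.ends} = ⋃ j, {f : Edge | f.ends = s(i, j)} := by
    ext f
    simp [Sym2.mem_iff_exists]
  have hd : Pairwise (Function.onFun Disjoint fun j => {f : Edge | f.ends = s(i, j)}) := by
    intro j k hjk
    refine Set.disjoint_left.2 fun f (hj : f.ends = _) (hk : f.ends = _) => hjk ?_
    exact Sym2.congr_right.1 (hj.symm.trans hk)
  rw [vertexMass, hU, Measure.real, measure_iUnion hd fun _ => .of_discrete,
    ENNReal.tsum_toReal_eq fun _ => measure_ne_top _ _]
  rfl

/-- Inclusion–exclusion over the two endpoints: only `e` itself contains both. -/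
theorem edgeMass_eq (e : Edge) : edgeMass μ e = μ.real {f | e.Touches f} := by
  obtain ⟨⟨i, j⟩, hij⟩ := e
  have hne : i ≠ j := fun h => hij (Sym2.mk_isDiag_iff.2 h)
  have hU : {f : Edge | Edge.Touches ⟨s(i, j), hij⟩ f}
      = {f | i ∈ f.ends} ∪ {f | j ∈ f.ends} := by
    ext f
    simp [Edge.Touches, Edge.ends, or_and_right, exists_or]
  have hI : {f : Edge | f.ends = s(i, j)} = {f | i ∈ f.ends} ∩ {f | j ∈ f.ends} := by
    ext f
    exact (Sym2.mem_and_mem_iff hne).symm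
  have := measureReal_union_add_inter (μ := μ) (s := {f : Edge | i ∈ f.ends})
    (t := {f : Edge | j ∈ f.ends}) .of_discrete
  change vertexMass μ i + vertexMass μ j - pairMass μ i j = _
  change _ = μ.real {f : Edge | Edge.Touches ⟨s(i, j), hij⟩ f}
  rw [hU, vertexMass_eq, vertexMass_eq, pairMass, hI]
  linarith

theorem measureReal_singleton_le_edgeMass (e : Edge) : μ.real {e} ≤ edgeMass μ e := by
  rw [edgeMass_eq]
  exact measureReal_mono (by rintro _ rfl; exact Edge.touches_self _)

end EdgeMass

/-! ### From finitely many expected births to connectedness -/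

section Probability

variable {Ω : Type*} [MeasurableSpace Ω] {P : Measure Ω} [IsProbabilityMeasure P]

/-- The events "`p` holds from `t` on" increase to an event of full measure. Continuity from below
along monotone families needs no measurability of `p`. -/
theorem tendsto_measure_one_of_ae_eventually {T : Type*} [LinearOrder T] [Nonempty T]
    [(atTop : Filter T).IsCountablyGenerated] {p : T → Ω → Prop}
    (h : ∀ᵐ ω ∂P, ∀ᶠ t in atTop, p t ω) : Tendsto (fun t => P {ω | p t ω}) atTop (𝓝 1) := by
  have hmono : Monotone fun t => {ω | ∀ s, t ≤ s → p s ω} :=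
    fun _ _ hab _ hω s hs => hω s (hab.trans hs)
  have hlim := tendsto_measure_iUnion_atTop (μ := P) hmono
  have hone : P (⋃ t, {ω | ∀ s, t ≤ s → p s ω}) = 1 := by
    rw [← measure_univ (μ := P)]
    refine measure_congr (eventuallyEq_univ.2 ?_)
    filter_upwards [h] with ω hω
    obtain ⟨t, ht⟩ := eventually_atTop.1 hω
    exact Set.mem_iUnion.2 ⟨t, ht⟩
  rw [hone] at hlim
  exact tendsto_of_tendsto_of_tendsto_of_le_of_le hlim tendsto_const_nhds
    (fun t => measure_mono fun ω hω => hω t le_rfl) fun t => prob_le_one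

/-- A random growing graph that fills up the support of `μ`, and in which the expected number of
births is finite, is connected with probability tending to `1`. -/
theorem tendsto_measure_connected {μ : Measure Edge} [IsFiniteMeasure μ]
    (hconn : (supportGraph μ).Connected)
    (hsum : Summable fun e : Edge => μ.real {e} / edgeMass μ e)
    {T : Type*} [LinearOrder T] [Nonempty T] [(atTop : Filter T).IsCountablyGenerated]
    {S : T → Ω → Set Edge} {c : ℕ → T} (hc : ∀ t, ∃ k, t ≤ c k)
    (hS : ∀ᵐ ω ∂P, Monotone fun t => S t ω) (h0 : ∀ᵐ ω ∂P, S (c 0) ω = ∅)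
    (hsub : ∀ᵐ ω ∂P, ∀ t, S t ω ⊆ {e | 0 < μ {e}})
    (hev : ∀ e, 0 < μ {e} → ∀ᵐ ω ∂P, ∃ t, e ∈ S t ω)
    (hborn : ∀ e, 0 < μ {e} → P {ω | Born (fun k => S (c k) ω) e}
      ≤ ENNReal.ofReal (2 * (μ.real {e} / edgeMass μ e))) :
    Tendsto (fun t => P {ω | (edgeGraph (S t ω)).Connected}) atTop (𝓝 1) := by
  have hle : ∀ e, P {ω | Born (fun k => S (c k) ω) e}
      ≤ ENNReal.ofReal (2 * (μ.real {e} / edgeMass μ e)) := by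
    intro e
    rcases (zero_le : 0 ≤ μ {e}).eq_or_lt with h | h
    · refine le_trans (le_of_eq (measure_eq_zero_iff_ae_notMem.2 ?_)) zero_le
      filter_upwards [hsub] with ω hω
      rintro ⟨k, hk, -⟩
      exact (ne_of_gt (hω _ hk)) h.symm
    · exact hborn e h
  -- Borel–Cantelli.
  have hfin := ae_finite_setOfPred_mem (ne_top_of_le_ne_top (hsum.mul_left 2).tsum_ofReal_ne_top
    (ENNReal.tsum_le_tsum hle))
  have hev' : ∀ᵐ ω ∂P, ∀ e ∈ {e | 0 < μ {e}}, ∃ t, e ∈ S t ω := by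
    refine ae_all_iff.2 fun e => ?_
    by_cases he : 0 < μ {e}
    · filter_upwards [hev e he] with ω hω _ using hω
    · exact .of_forall fun ω h => absurd h he
  refine tendsto_measure_one_of_ae_eventually ?_
  filter_upwards [hS, h0, hsub, hev', hfin] with ω h1 h2 h3 h4 h5
  exact eventually_connected (c := c) hconn h1 hc h2 h3 h4 h5

end Probability


variable {μ : Measure Edge} [IsProbabilityMeasure μ]
  {Ω : Type*} [MeasurableSpace Ω] {P : Measure Ω}

theorem edgeMass_pos {e : Edge} (he : 0 < μ {e}) : 0 < edgeMass μ e :=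
  (ENNReal.toReal_pos he.ne' (measure_ne_top _ _)).trans_le (measureReal_singleton_le_edgeMass μ e)

theorem edgeMass_le_one (e : Edge) : edgeMass μ e ≤ 1 := by
  rw [edgeMass_eq]; exact measureReal_le_one

/-! ### Discrete time -/

section Discrete

variable {X : ℕ → Ω → Edge}

theorem measure_born_discrete_le (hX : ∀ n, HasLaw (X n) μ P) (hind : iIndepFun X P) {e : Edge}
    (he : 0 < μ {e}) :
    P {ω | Born (fun n => {f | ∃ k < n, X k ω = f}) e}
      ≤ ENNReal.ofReal (2 * (μ.real {e} / edgeMass μ e)) := by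
  set B : Set Edge := {f | e.Touches f}
  let C : ℕ → ℕ → Set Edge := fun k j => if j = k then {e} else Bᶜ
  have hlaw : ∀ j (A : Set Edge), P (X j ⁻¹' A) = μ A := fun j A =>
    (hX j).measure_eq (p := fun x => x ∈ A) .of_discrete
  have hsub : {ω | Born (fun n => {f | ∃ k < n, X k ω = f}) e}
      ⊆ ⋃ k, ⋂ j ∈ Finset.range (k + 1), X j ⁻¹' C k j := by
    rintro ω ⟨k, ⟨j, hj, hje⟩, hk⟩
    -- Since `e` touches itself, it cannot have been drawn before step `k`.
    have hjk : j = k := by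
      by_contra hne
      exact hk e e.touches_self ⟨j, by omega, hje⟩
    subst hjk
    refine Set.mem_iUnion.2 ⟨j, Set.mem_iInter₂.2 fun i hi => ?_⟩
    by_cases hij : i = j
    · simpa [C, hij] using hje
    · have : ¬ e.Touches (X i ω) := fun h =>
        hk _ h ⟨i, by have := Finset.mem_range.1 hi; omega, rfl⟩
      simpa [C, hij, B] using this
  have hprob : ∀ k, P (⋂ j ∈ Finset.range (k + 1), X j ⁻¹' C k j) = (1 - μ B) ^ k * μ {e} := by
    intro k
    rw [hind.measure_inter_preimage_eq_mul _ fun _ _ => .of_discrete, Finset.prod_range_succ]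
    congr 1
    · rw [Finset.prod_congr rfl (g := fun _ => 1 - μ B), Finset.prod_const, Finset.card_range]
      intro j hj
      rw [hlaw, ← prob_compl_eq_one_sub .of_discrete]
      simp [C, (Finset.mem_range.1 hj).ne]
    · simp [hlaw, C]
  have hM := edgeMass_pos he
  calc P {ω | Born (fun n => {f | ∃ k < n, X k ω = f}) e}
      ≤ ∑' k, P (⋂ j ∈ Finset.range (k + 1), X j ⁻¹' C k j) :=
        (measure_mono hsub).trans (measure_iUnion_le _)
    _ = (μ B)⁻¹ * μ {e} := by
        simp_rw [hprob]
        rw [ENNReal.tsum_mul_right, ENNReal.tsum_geometric,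
          ENNReal.sub_sub_cancel ENNReal.one_ne_top prob_le_one]
    _ = ENNReal.ofReal (μ.real {e} / edgeMass μ e) := by
        rw [ENNReal.ofReal_div_of_pos hM, edgeMass_eq, ofReal_measureReal, ofReal_measureReal,
          mul_comm, div_eq_mul_inv]
    _ ≤ _ := ENNReal.ofReal_le_ofReal (le_mul_of_one_le_left
        (div_nonneg measureReal_nonneg hM.le) one_le_two)

theorem ae_exists_eq (hX : ∀ n, HasLaw (X n) μ P) (hind : iIndepFun X P) {e : Edge}
    (he : 0 < μ {e}) : ∀ᵐ ω ∂P, ∃ n, X n ω = e := by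
  have hle : ∀ n : ℕ, P {ω | ¬ ∃ n, X n ω = e} ≤ (1 - μ {e}) ^ n := by
    intro n
    calc P {ω | ¬ ∃ n, X n ω = e} ≤ P (⋂ j ∈ Finset.range n, X j ⁻¹' {e}ᶜ) :=
          measure_mono fun ω hω => Set.mem_iInter₂.2 fun j _ hj => hω ⟨j, hj⟩
      _ = (1 - μ {e}) ^ n := by
          rw [hind.measure_inter_preimage_eq_mul _ fun _ _ => .of_discrete,
            Finset.prod_congr rfl (g := fun _ => 1 - μ {e}), Finset.prod_const, Finset.card_range]
          intro j _
          rw [← prob_compl_eq_one_sub .of_discrete]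
          exact (hX j).measure_eq (p := fun x => x ∈ ({e} : Set Edge)ᶜ) .of_discrete
  have hlt : 1 - μ {e} < 1 := ENNReal.sub_lt_self ENNReal.one_ne_top one_ne_zero he.ne'
  exact le_antisymm (ge_of_tendsto' (ENNReal.tendsto_pow_atTop_nhds_zero_of_lt_one hlt) hle)
    zero_le

theorem tendsto_measure_discreteGraph_connected [IsProbabilityMeasure P]
    (hconn : (supportGraph μ).Connected)
    (hsum : Summable fun e : Edge => μ.real {e} / edgeMass μ e)
    (hX : ∀ n, HasLaw (X n) μ P) (hind : iIndepFun X P) :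
    Tendsto (fun n : ℕ => P {ω | (discreteGraph (fun k => X k ω) n).Connected}) atTop (𝓝 1) := by
  simp_rw [discreteGraph_eq_edgeGraph]
  refine tendsto_measure_connected (S := fun n ω => {f | ∃ k < n, X k ω = f}) (c := id) hconn hsum
    (fun t => ⟨t, le_rfl⟩) (.of_forall fun ω m n hmn => ?_) (.of_forall fun ω => ?_) ?_ ?_
    (fun e => measure_born_discrete_le hX hind)
  · rintro f ⟨k, hk, hf⟩
    exact ⟨k, hk.trans_le hmn, hf⟩
  · simp
  · have hpos : ∀ᵐ f ∂μ, 0 < μ {f} := by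
      rw [ae_iff_of_countable]
      exact fun f hf => pos_iff_ne_zero.2 hf
    have hall : ∀ᵐ ω ∂P, ∀ k, 0 < μ {X k ω} :=
      ae_all_iff.2 fun k => ((hX k).ae_iff (measurable_from_top)).2 hpos
    filter_upwards [hall] with ω hω n
    rintro _ ⟨k, -, rfl⟩
    exact hω k
  · intro e he
    filter_upwards [ae_exists_eq hX hind he] with ω ⟨n, hn⟩
    exact ⟨n + 1, n, n.lt_succ_self, hn⟩

end Discrete

/-! ### Continuous time -/

section Poisson

theorem IsPoissonProcess.measureReal_eq_zero {N : ℝ≥0 → Ω → ℕ} {r : ℝ≥0}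
    (hN : IsPoissonProcess N r P) (t : ℝ≥0) : P.real {ω | N t ω = 0} = Real.exp (-(t * r)) := by
  have hlaw : HasLaw (N t) (poissonMeasure (r * t)) P := by
    have := hN.law_increment 0 t zero_le
    rw [tsub_zero] at this
    refine this.congr ?_
    filter_upwards [hN.start] with ω hω
    simp [hω]
  rw [hlaw.measureReal_eq (p := fun x => x = 0) .of_discrete]
  change (poissonMeasure (r * t)).real {0} = _
  rw [poissonMeasure_real_singleton]
  simp [mul_comm]

/-- By monotonicity the probability is the difference of the two void probabilities, `exp(-k r) (1 -
exp(-r))`, and `1 - exp(-r) ≤ r`. -/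
theorem IsPoissonProcess.measureReal_eq_zero_and_pos_le [IsProbabilityMeasure P]
    {N : ℝ≥0 → Ω → ℕ} {r : ℝ≥0}
    (hN : IsPoissonProcess N r P) (k : ℕ) :
    P.real {ω | N k ω = 0 ∧ 0 < N (k + 1) ω} ≤ Real.exp (-(k * r)) * r := by
  have hae : ({ω | N (k + 1 : ℝ≥0) ω = 0} : Set Ω) ≤ᵐ[P] {ω | N k ω = 0} := by
    filter_upwards [hN.monotone] with ω hω (h : N (k + 1) ω = 0)
    have : N k ω ≤ N (k + 1) ω := hω (by simp)
    exact Nat.le_zero.1 (h ▸ this)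
  have hm : MeasurableSet {ω | N (k + 1 : ℝ≥0) ω = 0} := hN.measurable _ (.singleton 0)
  have hsplit := measureReal_inter_add_sdiff (μ := P) (s := {ω | N k ω = 0}) hm
  have hdiff : {ω | N k ω = 0} \ {ω | N (k + 1 : ℝ≥0) ω = 0}
      = {ω | N k ω = 0 ∧ 0 < N (k + 1) ω} := by
    ext ω
    simp [Nat.pos_iff_ne_zero]
  have hinter : P.real ({ω | N k ω = 0} ∩ {ω | N (k + 1 : ℝ≥0) ω = 0})
      = P.real {ω | N (k + 1 : ℝ≥0) ω = 0} := by
    refine measureReal_congr ?_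
    filter_upwards [hae] with ω hω
    exact propext ⟨fun h => h.2, fun h => ⟨hω h, h⟩⟩
  rw [hdiff, hinter, hN.measureReal_eq_zero, hN.measureReal_eq_zero] at hsplit
  have hexp : Real.exp (-(((k + 1 : ℝ≥0) : ℝ) * r)) = Real.exp (-(k * r)) * Real.exp (-r) := by
    rw [← Real.exp_add]
    push_cast
    ring_nf
  rw [hexp, NNReal.coe_natCast] at hsplit
  nlinarith [Real.exp_pos (-(k * r : ℝ)), Real.add_one_le_exp (-(r : ℝ))]

/-- Monotonicity reduces the uncountably many times to the integers. -/
theorem IsPoissonProcess.ae_eq_zero [IsProbabilityMeasure P]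
    {N : ℝ≥0 → Ω → ℕ} (hN : IsPoissonProcess N 0 P) :
    ∀ᵐ ω ∂P, ∀ t, N t ω = 0 := by
  have hnat : ∀ᵐ ω ∂P, ∀ k : ℕ, N k ω = 0 := by
    refine ae_all_iff.2 fun k => ?_
    have hm : MeasurableSet {ω | N k ω = 0} := hN.measurable _ (.singleton 0)
    refine (prob_compl_eq_zero_iff hm).2 ?_
    have := hN.measureReal_eq_zero k
    simpa [Measure.real, ENNReal.toReal_eq_one_iff] using this
  filter_upwards [hnat, hN.monotone] with ω h0 hmono t
  obtain ⟨k, hk⟩ := exists_nat_ge t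
  have : N t ω ≤ N k ω := hmono hk
  exact Nat.le_zero.1 (h0 k ▸ this)

theorem IsPoissonProcess.ae_exists_pos [IsProbabilityMeasure P]
    {N : ℝ≥0 → Ω → ℕ} {r : ℝ≥0}
    (hN : IsPoissonProcess N r P) (hr : 0 < r) : ∀ᵐ ω ∂P, ∃ t, 0 < N t ω := by
  have hle : ∀ k : ℕ, P.real {ω | ¬ ∃ t, 0 < N t ω} ≤ Real.exp (-r) ^ k := by
    intro k
    rw [← Real.exp_nat_mul, mul_neg, ← NNReal.coe_natCast, ← hN.measureReal_eq_zero]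
    refine measureReal_mono fun ω hω => ?_
    by_contra hne
    exact hω ⟨k, Nat.pos_of_ne_zero hne⟩
  have hlim := tendsto_pow_atTop_nhds_zero_of_lt_one (Real.exp_pos (-r)).le
    (Real.exp_lt_one_iff.2 (neg_lt_zero.2 (NNReal.coe_pos.2 hr)))
  exact (measureReal_eq_zero_iff).1 (le_antisymm (ge_of_tendsto' hlim hle) measureReal_nonneg)

/-- The geometric sum is `1 / (1 - exp(-M))`. From `exp(-M) (1 + M) ≤ 1` follows `1 - exp(-M) ≥ M /
(1 + M) ≥ M / 2`; this is the source of the factor `2` in the birth bound. -/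
theorem tsum_exp_neg_nat_mul_le {M : ℝ} (h0 : 0 < M) (h1 : M ≤ 1) :
    Summable (fun k : ℕ => Real.exp (-(k * M))) ∧
      ∑' k : ℕ, Real.exp (-(k * M)) ≤ 2 / M := by
  have hpow : (fun k : ℕ => Real.exp (-(k * M))) = fun k => Real.exp (-M) ^ k := by
    ext k
    rw [← Real.exp_nat_mul, mul_neg]
  have hlt : Real.exp (-M) < 1 := Real.exp_lt_one_iff.2 (neg_lt_zero.2 h0)
  rw [hpow, tsum_geometric_of_lt_one (Real.exp_pos _).le hlt]
  refine ⟨summable_geometric_of_lt_one (Real.exp_pos _).le hlt, ?_⟩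
  have hmul : Real.exp (-M) * Real.exp M = 1 := by rw [← Real.exp_add]; simp
  rw [inv_le_comm₀ (by linarith) (by positivity), inv_div]
  nlinarith [Real.add_one_le_exp M, Real.exp_pos (-M)]

variable {N : Edge → ℝ≥0 → Ω → ℕ}

/-- Infinitely many edges may touch `e`, so independence is applied to finite sets `F` containing
`e`, and then `F` grows to all edges. Independence of whole paths is used because the factor of `e`
involves two times. -/
theorem measureReal_born_step_le [IsProbabilityMeasure P]
    (hN : ∀ e, IsPoissonProcess (N e) (μ {e}).toNNReal P)
    (hind : iIndepFun (fun e ω t => N e t ω) P) (e : Edge) (k : ℕ) :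
    P.real {ω | 0 < N e (k + 1) ω ∧ ∀ f, e.Touches f → N f k ω = 0}
      ≤ Real.exp (-(k * edgeMass μ e)) * μ.real {e} := by
  classical
  -- The rate at which `f` obstructs a birth of `e`; these rates sum to `M_e`.
  let w : Edge → ℝ := fun f => ({f | e.Touches f}.indicator (fun f => μ {f}) f).toReal
  have hw : HasSum w (edgeMass μ e) := by
    have htsum := Measure.tsum_indicator_apply_singleton μ {f | e.Touches f} .of_discrete
    have hne : ∑' f, {f | e.Touches f}.indicator (fun f => μ {f}) f ≠ ∞ :=
      htsum ▸ measure_ne_top _ _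
    have := ENNReal.hasSum_toReal hne
    rwa [← ENNReal.tsum_toReal_eq fun f => ENNReal.ne_top_of_tsum_ne_top hne f, htsum,
      ← Measure.real, ← edgeMass_eq] at this
  let C : Edge → Set (ℝ≥0 → ℕ) := fun f =>
    if f = e then {g | g k = 0 ∧ 0 < g (k + 1)}
    else if e.Touches f then {g | g k = 0} else Set.univ
  have hC : ∀ f, MeasurableSet (C f) := by
    intro f
    have h1 : MeasurableSet {g : ℝ≥0 → ℕ | g k = 0} :=
      measurable_pi_apply (k : ℝ≥0) (.singleton 0)
    have h2 : MeasurableSet {g : ℝ≥0 → ℕ | 0 < g (k + 1)} :=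
      measurable_pi_apply (k + 1 : ℝ≥0) measurableSet_Ioi
    dsimp only [C]
    split_ifs
    exacts [h1.inter h2, h1, .univ]
  have hrate : ∀ f, ((μ {f}).toNNReal : ℝ) = μ.real {f} := fun f => rfl
  have hfac : ∀ f, P.real ((fun ω t => N f t ω) ⁻¹' C f)
      ≤ Real.exp (-(k * w f)) * if f = e then μ.real {e} else 1 := by
    intro f
    by_cases hfe : f = e
    · subst hfe
      have hwf : w f = μ.real {f} := by
        simp [w, Set.indicator, f.touches_self, Measure.real]
      simpa [C, hwf, hrate] using (hN f).measureReal_eq_zero_and_pos_le k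
    · by_cases ht : e.Touches f
      · have hwf : w f = μ.real {f} := by simp [w, Set.indicator, ht, Measure.real]
        have := ((hN f).measureReal_eq_zero k).le
        simpa [C, hfe, ht, hwf, hrate] using this
      · have hwf : w f = 0 := by simp [w, Set.indicator, ht]
        simp [C, hfe, ht, hwf]
  have hF : ∀ F : Finset Edge, e ∈ F →
      P.real {ω | 0 < N e (k + 1) ω ∧ ∀ f, e.Touches f → N f k ω = 0}
        ≤ Real.exp (-(k * ∑ f ∈ F, w f)) * μ.real {e} := by
    intro F heF
    calc P.real {ω | 0 < N e (k + 1) ω ∧ ∀ f, e.Touches f → N f k ω = 0}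
        ≤ P.real (⋂ f ∈ F, (fun ω t => N f t ω) ⁻¹' C f) := by
          refine measureReal_mono ?_
          rintro ω ⟨hpos, hzero⟩
          refine Set.mem_iInter₂.2 fun f _ => ?_
          simp only [C, Set.mem_preimage]
          split_ifs with h1 h2
          · subst h1; exact ⟨hzero _ f.touches_self, hpos⟩
          · exact hzero f h2
          · trivial
      _ = ∏ f ∈ F, P.real ((fun ω t => N f t ω) ⁻¹' C f) := by
          rw [Measure.real, hind.measure_inter_preimage_eq_mul F fun f _ => hC f,
            ENNReal.toReal_prod]
          rfl
      _ ≤ ∏ f ∈ F, (Real.exp (-(k * w f)) * if f = e then μ.real {e} else 1) :=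
          Finset.prod_le_prod (fun _ _ => measureReal_nonneg) fun f _ => hfac f
      _ = Real.exp (-(k * ∑ f ∈ F, w f)) * μ.real {e} := by
          rw [Finset.prod_mul_distrib, ← Real.exp_sum, Finset.prod_ite_eq' F e, if_pos heF,
            Finset.sum_neg_distrib, ← Finset.mul_sum]
  have hlim : Tendsto (fun F : Finset Edge => Real.exp (-(k * ∑ f ∈ F, w f)) * μ.real {e})
      atTop (𝓝 (Real.exp (-(k * edgeMass μ e)) * μ.real {e})) :=
    ((Real.continuous_exp.tendsto _).comp (Tendsto.const_mul (k : ℝ) hw).neg).mul_const _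
  refine ge_of_tendsto hlim ?_
  filter_upwards [eventually_ge_atTop {e}] with F hFe
  exact hF F (hFe (Finset.mem_singleton_self e))

theorem measure_born_poisson_le [IsProbabilityMeasure P]
    (hN : ∀ e, IsPoissonProcess (N e) (μ {e}).toNNReal P)
    (hind : iIndepFun (fun e ω t => N e t ω) P) {e : Edge} (he : 0 < μ {e}) :
    P {ω | Born (fun k : ℕ => {f | 0 < N f k ω}) e}
      ≤ ENNReal.ofReal (2 * (μ.real {e} / edgeMass μ e)) := by
  have hsub : {ω | Born (fun k : ℕ => {f | 0 < N f k ω}) e}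
      ⊆ ⋃ k : ℕ, {ω | 0 < N e (k + 1) ω ∧ ∀ f, e.Touches f → N f k ω = 0} := by
    rintro ω ⟨k, hk, hf⟩
    refine Set.mem_iUnion.2 ⟨k, ?_, fun f hef => Nat.eq_zero_of_not_pos (hf f hef)⟩
    simpa using hk
  obtain ⟨hs, hle⟩ := tsum_exp_neg_nat_mul_le (edgeMass_pos he) (edgeMass_le_one (μ := μ) e)
  calc P {ω | Born (fun k : ℕ => {f | 0 < N f k ω}) e}
      ≤ ∑' k : ℕ, P {ω | 0 < N e (k + 1) ω ∧ ∀ f, e.Touches f → N f k ω = 0} :=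
        (measure_mono hsub).trans (measure_iUnion_le _)
    _ ≤ ∑' k : ℕ, ENNReal.ofReal (Real.exp (-(k * edgeMass μ e)) * μ.real {e}) :=
        ENNReal.tsum_le_tsum fun k => by
          rw [← ofReal_measureReal]
          exact ENNReal.ofReal_le_ofReal (measureReal_born_step_le hN hind e k)
    _ = ENNReal.ofReal ((∑' k : ℕ, Real.exp (-(k * edgeMass μ e))) * μ.real {e}) := by
        rw [← ENNReal.ofReal_tsum_of_nonneg
          (fun k => mul_nonneg (Real.exp_pos _).le measureReal_nonneg) (hs.mul_right _),
          tsum_mul_right]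
    _ ≤ ENNReal.ofReal (2 * (μ.real {e} / edgeMass μ e)) := by
        refine ENNReal.ofReal_le_ofReal
          ((mul_le_mul_of_nonneg_right hle measureReal_nonneg).trans_eq ?_)
        ring

theorem tendsto_measure_countGraph_connected [IsProbabilityMeasure P]
    (hconn : (supportGraph μ).Connected)
    (hsum : Summable fun e : Edge => μ.real {e} / edgeMass μ e)
    (hN : ∀ e, IsPoissonProcess (N e) (μ {e}).toNNReal P)
    (hind : iIndepFun (fun e ω t => N e t ω) P) :
    Tendsto (fun t : ℝ≥0 => P {ω | (countGraph (fun e => N e t ω)).Connected}) atTop (𝓝 1) := by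
  refine tendsto_measure_connected (S := fun t ω => {f | 0 < N f t ω}) (c := fun k : ℕ => (k : ℝ≥0))
    hconn hsum (fun t => exists_nat_ge t) ?_ ?_ ?_ ?_
    (fun e => measure_born_poisson_le hN hind)
  · filter_upwards [ae_all_iff.2 fun e => (hN e).monotone] with ω hω s t hst f hf
    exact lt_of_lt_of_le hf (hω f hst)
  · filter_upwards [ae_all_iff.2 fun e => (hN e).start] with ω hω
    simp [hω]
  · have hzero : ∀ᵐ ω ∂P, ∀ e, μ {e} = 0 → ∀ t, N e t ω = 0 := by
      refine ae_all_iff.2 fun e => ?_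
      by_cases he : μ {e} = 0
      · have hNe := hN e
        rw [he, ENNReal.toNNReal_zero] at hNe
        filter_upwards [hNe.ae_eq_zero] with ω hω _ using hω
      · exact .of_forall fun ω h => absurd h he
    filter_upwards [hzero] with ω hω t e he
    exact pos_iff_ne_zero.2 fun h => (ne_of_gt he) (hω e h t)
  · intro e he
    exact (hN e).ae_exists_pos (ENNReal.toNNReal_pos he.ne' (measure_ne_top _ _))

end Poisson

end EdgeExch

theorem corollary4p3 (μ : Measure EdgeExch.Edge) [IsProbabilityMeasure μ]
    (hconn : (EdgeExch.supportGraph μ).Connected)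
    (hsum : Summable fun e : EdgeExch.Edge => μ.real {e} / EdgeExch.edgeMass μ e) :
    -- discrete time: the edges are i.i.d. with law `μ`
    (∀ (Ω : Type*) [MeasurableSpace Ω] (P : Measure Ω) [IsProbabilityMeasure P]
        (X : ℕ → Ω → EdgeExch.Edge),
        (∀ n, Measurable (X n)) → (∀ n, HasLaw (X n) μ P) → iIndepFun X P →
        Tendsto (fun n : ℕ =>
            P {ω | (EdgeExch.discreteGraph (fun k => X k ω) n).Connected})
          atTop (𝓝 1)) ∧
    -- continuous time: independent Poisson processes, the one of `e` with intensity `μ({e})`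
    (∀ (Ω : Type*) [MeasurableSpace Ω] (P : Measure Ω) [IsProbabilityMeasure P]
        (N : EdgeExch.Edge → ℝ≥0 → Ω → ℕ),
        (∀ e, EdgeExch.IsPoissonProcess (N e) (μ {e}).toNNReal P) →
        iIndepFun (fun e ω t => N e t ω) P →
        Tendsto (fun t : ℝ≥0 =>
            P {ω | (EdgeExch.countGraph (fun e => N e t ω)).Connected})
          atTop (𝓝 1)) := by
  refine ⟨?_, ?_⟩
  · intro Ω _ P _ X _ hX hind
    exact EdgeExch.tendsto_measure_discreteGraph_connected hconn hsum hX hind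
  · intro Ω _ P _ N hN hind
    exact EdgeExch.tendsto_measure_countGraph_connected hconn hsum hN hind
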